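/- Let $\mathbf H^2\times\mathbf R$ be given by its projective model: in affine coordinates $(x,y,z)$ it is the open half cone $$\{(x,y,z)\in\mathbf R^3:\ -x^2+y^2+z^2<0<x\}$$ with the Riemannian metric $$ds^2=\frac{(x^2+y^2+z^2)\,dx^2-4xy\,dx\,dy-4xz\,dx\,dz+(x^2+y^2-z^2)\,dy^2+4yz\,dy\,dz+(x^2-y^2+z^2)\,dz^2}{(-x^2+y^2+z^2)^2}$$ (equivalently $ds^2=dt^2+dr^2+\sinh^2 r\,d\alpha^2$ for $x=e^t\cosh r$, $y=e^t\sinh r\cos\alpha$, $z=e^t\sinh r\sin\alpha$). A geodesic triangle consists of three different points $A_1,A_2,A_3$ of $\mathbf H^2\times\mathbf R$ together with geodesic segments (solutions of the geodesic equation of $ds^2$) connecting them pairwise. The interior angle $\omega_i\in[0,\pi]$ at $A_i$ is the angle, measured with the metric tensor $g$ at $A_i$ by $$\cos\omega_i=\frac{g(\mathbf u,\mathbf v)}{\sqrt{g(\mathbf u,\mathbf u)\,g(\mathbf v,\mathbf v)}},$$ between the tangent vectors $\mathbf u,\mathbf v$ at $A_i$ of the two sides meeting there, both oriented away from $A_i$.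 **Theorem.** For every geodesic triangle of $\mathbf H^2\times\mathbf R$ the sum of the interior angles satisfies $$\omega_1+\omega_2+\omega_3\le\pi .$$ -/

import Mathlib

namespace H2R

/-- The points of `H² × R` in the affine coordinates `(x, y, z) = (p 0, p 1, p 2)` of the
projective model, normalised by `x⁰ = 1`: the open half cone `-x² + y² + z² < 0 < x`. -/
def space : Set (Fin 3 → ℝ) :=
  {p | -(p 0) ^ 2 + (p 1) ^ 2 + (p 2) ^ 2 < 0 ∧ 0 < p 0}

/-- The metric tensor `g_{ij}` of `H² × R` in the coordinates `(x, y, z)`. -/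
noncomputable def metric (p : Fin 3 → ℝ) : Matrix (Fin 3) (Fin 3) ℝ :=
  (1 / (-(p 0) ^ 2 + (p 1) ^ 2 + (p 2) ^ 2) ^ 2) •
    !![(p 0) ^ 2 + (p 1) ^ 2 + (p 2) ^ 2, -2 * p 0 * p 1, -2 * p 0 * p 2;
       -2 * p 0 * p 1, (p 0) ^ 2 + (p 1) ^ 2 - (p 2) ^ 2, 2 * p 1 * p 2;
       -2 * p 0 * p 2, 2 * p 1 * p 2, (p 0) ^ 2 - (p 1) ^ 2 + (p 2) ^ 2]

/-- The Riemannian inner product `u^i g_{ij} v^j` of two tangent vectors at `p`. -/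
noncomputable def metricInner (p u v : Fin 3 → ℝ) : ℝ :=
  ∑ i, ∑ j, u i * metric p i j * v j

/-- The partial derivative `∂_l g_{ij}` at `p`. -/
noncomputable def metricDeriv (p : Fin 3 → ℝ) (l i j : Fin 3) : ℝ :=
  fderiv ℝ (fun q : Fin 3 → ℝ => metric q i j) p (Pi.single l 1)

/-- The Christoffel symbol `Γ^k_{ij}` of the Levi-Civita connection at `p`. -/
noncomputable def christoffel (p : Fin 3 → ℝ) (k i j : Fin 3) : ℝ :=
  (1 / 2) * ∑ l, (metric p)⁻¹ k l *
    (metricDeriv p i j l + metricDeriv p j i l - metricDeriv p l i j)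

/-- The velocity (one-sided at the ends) of a curve parametrised by `[0, 1]`. -/
noncomputable def velocity (γ : ℝ → Fin 3 → ℝ) (s : ℝ) : Fin 3 → ℝ :=
  derivWithin γ (Set.Icc 0 1) s

/-- The coordinate acceleration (one-sided at the ends) of a curve parametrised by `[0, 1]`. -/
noncomputable def acceleration (γ : ℝ → Fin 3 → ℝ) (s : ℝ) : Fin 3 → ℝ :=
  derivWithin (velocity γ) (Set.Icc 0 1) s

/-- `γ`, restricted to `[0, 1]`, is a geodesic segment of `H² × R` from `P` to `Q`: a `C²` curve
in the space satisfying the geodesic equation of the Riemannian metric. -/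
structure IsGeodesicSegment (γ : ℝ → Fin 3 → ℝ) (P Q : Fin 3 → ℝ) : Prop where
  contDiffOn : ContDiffOn ℝ 2 γ (Set.Icc 0 1)
  mem_space : ∀ s ∈ Set.Icc (0 : ℝ) 1, γ s ∈ space
  source : γ 0 = P
  target : γ 1 = Q
  geodesic_eq : ∀ s ∈ Set.Icc (0 : ℝ) 1, ∀ k : Fin 3,
    acceleration γ s k +
      ∑ i, ∑ j, christoffel (γ s) k i j * velocity γ s i * velocity γ s j = 0

/-- The angle between two tangent vectors at `p`, measured with the metric tensor. -/
noncomputable def angle (p u v : Fin 3 → ℝ) : ℝ :=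
  Real.arccos (metricInner p u v / Real.sqrt (metricInner p u u * metricInner p v v))

/-- A geodesic triangle: three different points of the space, with pairwise connecting geodesic
segments. Indices are read cyclically, and `side k` is opposite to the vertex `k`. -/
structure GeodesicTriangle where
  vertex : Fin 3 → Fin 3 → ℝ
  vertex_mem : ∀ k, vertex k ∈ space
  vertex_injective : Function.Injective vertex
  side : Fin 3 → ℝ → Fin 3 → ℝ
  side_geodesic : ∀ k, IsGeodesicSegment (side k) (vertex (k + 1)) (vertex (k + 2))

/-- The interior angle at the vertex `k`: the angle between the tangent vectors there of the two
adjacent sides, both oriented away from the vertex. The side `k + 2` leaves the vertex `k`, and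
the side `k + 1` arrives there, so its final velocity is reversed. -/
noncomputable def GeodesicTriangle.interiorAngle (T : GeodesicTriangle) (k : Fin 3) : ℝ :=
  angle (T.vertex k) (velocity (T.side (k + 2)) 0) (-velocity (T.side (k + 1)) 1)

end H2R

/-! The space is a product of nonpositively curved factors, so each interior angle is at most the
angle of the Euclidean triangle with the same side lengths, and Euclidean angles add up to `π`.

With `q = coneForm`, the height is `t = log q / 2` and the metric is `⟨·,·⟩/q + 2 dt²`. The geodesic
equation then involves only Lorentzian products. Two of their quotients by `q` are first integrals,
which makes the equation linear with constant coefficients (`IsGeodesicSegment.exists_linear`).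
Solving it expresses each side by its height change `τ` and hyperbolic length `κ`, with squared
length `τ² + κ²`.

The heights obey the Euclidean law of cosines exactly. The hyperbolic law implies a Euclidean
inequality because `cosh ∘ √` is convex. Adding the two gives `IsExp.law_of_cosines`. No triangle
inequality is needed, since `arccos_law_of_cosines_add_le` covers its failure. -/

namespace H2R

/-! ### Metric and Christoffel symbols -/

/-- The Lorentzian inner product of signature `(-, +, +)`. -/
def lorentz (u v : Fin 3 → ℝ) : ℝ := -(u 0 * v 0) + u 1 * v 1 + u 2 * v 2

/-- The quadratic form `x² - y² - z²`, positive on `space`. -/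
def coneForm (p : Fin 3 → ℝ) : ℝ := p 0 ^ 2 - p 1 ^ 2 - p 2 ^ 2

/-- The diagonal of the Lorentzian form. -/
def lorentzSign : Fin 3 → ℝ := ![-1, 1, 1]

theorem coneForm_pos {p : Fin 3 → ℝ} (hp : p ∈ space) : 0 < coneForm p := by
  have := hp.1
  unfold coneForm
  linarith

theorem metric_apply {p : Fin 3 → ℝ} (i j : Fin 3) :
    metric p i j = (2 * (lorentzSign i * p i) * (lorentzSign j * p j)
      + coneForm p * (if i = j then lorentzSign i else 0)) / coneForm p ^ 2 := by
  have h : (-(p 0) ^ 2 + (p 1) ^ 2 + (p 2) ^ 2) ^ 2 = coneForm p ^ 2 := by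
    unfold coneForm; ring
  unfold metric
  rw [h]
  fin_cases i <;> fin_cases j <;> simp [lorentzSign, coneForm] <;> ring

/-- On the cone the Lorentzian form is `q (h - dt²)`, with `h` the hyperbolic metric, and `dt = -⟨p,
·⟩/q`; hence `h + dt² = ⟨·,·⟩/q + 2 dt²`. -/
theorem metricInner_eq {p : Fin 3 → ℝ} (hp : p ∈ space) (u v : Fin 3 → ℝ) :
    metricInner p u v =
      lorentz u v / coneForm p + 2 * (lorentz p u / coneForm p) * (lorentz p v / coneForm p) := by
  have hq := (coneForm_pos hp).ne'
  simp only [metricInner, metric_apply, Fin.sum_univ_three]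
  simp [lorentzSign, lorentz]
  field_simp
  ring

theorem metricDeriv_eq {p : Fin 3 → ℝ} (hp : p ∈ space) (l i j : Fin 3) :
    metricDeriv p l i j =
      ((2 * lorentzSign i * lorentzSign j *
          ((if i = l then 1 else 0) * p j + p i * (if j = l then 1 else 0))
        - 2 * lorentzSign l * p l * (if i = j then lorentzSign i else 0)) * coneForm p
      + 4 * lorentzSign l * p l * (2 * (lorentzSign i * p i) * (lorentzSign j * p j)
        + coneForm p * (if i = j then lorentzSign i else 0))) / coneForm p ^ 3 := by
  have hq := (coneForm_pos hp).ne'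
  set e : Fin 3 → ℝ := Pi.single l 1 with he
  have hcoord (m : Fin 3) : HasDerivAt (fun t : ℝ => (p + t • e) m)
      (if m = l then (1 : ℝ) else 0) 0 := by
    simp only [he, Pi.add_apply, Pi.smul_apply, Pi.single_apply, smul_eq_mul]
    simpa using ((hasDerivAt_id (0 : ℝ)).mul_const (if m = l then (1 : ℝ) else 0)).const_add (p m)
  have hcone : HasDerivAt (fun t : ℝ => coneForm (p + t • e))
      (-2 * lorentzSign l * p l) 0 := by
    unfold coneForm
    refine ((((hcoord 0).pow 2).sub ((hcoord 1).pow 2)).sub ((hcoord 2).pow 2)).congr_deriv ?_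
    fin_cases l <;> simp [lorentzSign]
  have hdiff : DifferentiableAt ℝ (fun q : Fin 3 → ℝ => metric q i j) p := by
    simp only [metric_apply, div_eq_mul_inv]
    refine DifferentiableAt.fun_mul ?_ (DifferentiableAt.fun_inv ?_ ?_)
    · unfold coneForm; fun_prop
    · unfold coneForm; fun_prop
    · exact pow_ne_zero 2 hq
  have hline := ((((hcoord i).const_mul (lorentzSign i)).const_mul 2).mul
      ((hcoord j).const_mul (lorentzSign j))).add
        (hcone.mul_const (if i = j then lorentzSign i else 0)) |>.div (hcone.pow 2)
        (by simpa using hq)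
  rw [metricDeriv, ← hdiff.lineDeriv_eq_fderiv, lineDeriv]
  simp only [metric_apply]
  refine (hline.congr_deriv ?_).deriv
  simp only [zero_smul, add_zero, Pi.add_apply, Pi.zero_apply, Pi.mul_apply,
    Pi.pow_apply, add_zero]
  push_cast
  field_simp
  ring

/-- Sherman–Morrison for a rank-one perturbation of a diagonal matrix; the denominator is `1 + 2⟨p,
p⟩/q = -1`. -/
theorem metric_inv {p : Fin 3 → ℝ} (hp : p ∈ space) :
    (metric p)⁻¹ = Matrix.of fun i j =>
      2 * p i * p j + coneForm p * (if i = j then lorentzSign i else 0) := by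
  have hq := (coneForm_pos hp).ne'
  apply Matrix.inv_eq_right_inv
  ext i j
  simp only [Matrix.mul_apply, Fin.sum_univ_three, metric_apply, Matrix.of_apply]
  fin_cases i <;> fin_cases j <;> simp [lorentzSign] <;> field_simp <;>
    simp only [coneForm] <;> ring

theorem christoffel_eq {p : Fin 3 → ℝ} (hp : p ∈ space) (k i j : Fin 3) :
    christoffel p k i j =
      (lorentzSign i * p i * (if k = j then 1 else 0)
        + lorentzSign j * p j * (if k = i then 1 else 0)
        - (if i = j then lorentzSign i else 0) * p k) / coneForm p := by
  have hq := (coneForm_pos hp).ne'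
  simp only [christoffel, metric_inv hp, metricDeriv_eq hp, Fin.sum_univ_three, Matrix.of_apply]
  fin_cases k <;> fin_cases i <;> fin_cases j <;> simp [lorentzSign] <;> field_simp <;>
    simp only [coneForm] <;> ring

theorem christoffel_quadratic {p : Fin 3 → ℝ} (hp : p ∈ space) (v : Fin 3 → ℝ) (k : Fin 3) :
    ∑ i, ∑ j, christoffel p k i j * v i * v j =
      2 * (lorentz p v / coneForm p) * v k - lorentz v v / coneForm p * p k := by
  have hq := (coneForm_pos hp).ne'
  simp only [christoffel_eq hp, Fin.sum_univ_three]
  fin_cases k <;> simp [lorentzSign, lorentz] <;> field_simp <;> ring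

/-! ### Euclidean comparison -/

/-- `cosh ∘ √` is convex on `[0, ∞)`. -/
theorem convexOn_cosh_sqrt : ConvexOn ℝ (Set.Ici 0) fun x => Real.cosh √x := by
  -- The power series in `x` has nonnegative coefficients, so convexity holds term by term.
  have hsum {x : ℝ} (hx : 0 ≤ x) :
      HasSum (fun n : ℕ => x ^ n / ((2 * n).factorial : ℝ)) (Real.cosh √x) := by
    simpa only [pow_mul, Real.sq_sqrt hx] using Real.hasSum_cosh √x
  refine ⟨convex_Ici 0, fun x hx y hy a b ha hb hab => ?_⟩
  simp only [Set.mem_Ici, smul_eq_mul] at *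
  refine hasSum_le (fun n => ?_) (hsum (by positivity))
    (((hsum hx).mul_left a).add ((hsum hy).mul_left b))
  have := (convexOn_pow n).2 hx hy ha hb hab
  simp only [smul_eq_mul] at this
  calc _ ≤ (a * x ^ n + b * y ^ n) / ((2 * n).factorial : ℝ) := by gcongr
    _ = _ := by ring

/-- Comparison of the hyperbolic with the Euclidean law of cosines. -/
theorem sq_ge_of_hyperbolic_law_of_cosines {a b c k : ℝ} (hc : 0 ≤ c) (hk : |k| ≤ 1)
    (h : Real.cosh c = Real.cosh a * Real.cosh b - Real.sinh a * Real.sinh b * k) :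
    a ^ 2 + b ^ 2 - 2 * a * b * k ≤ c ^ 2 := by
  obtain ⟨h1, h2⟩ := abs_le.1 hk
  -- The weights `(1 ∓ k)/2` average `cosh (a ± b)` to the hyperbolic right-hand side and `(a ± b)²`
  -- to the Euclidean one.
  have hconv := convexOn_cosh_sqrt.2 (sq_nonneg (a + b)) (sq_nonneg (a - b))
    (show 0 ≤ (1 - k) / 2 by linarith) (show 0 ≤ (1 + k) / 2 by linarith) (by ring)
  simp only [smul_eq_mul, Real.sqrt_sq_eq_abs, Real.cosh_abs, Real.cosh_add, Real.cosh_sub]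
    at hconv
  have h3 : (1 - k) / 2 * (a + b) ^ 2 + (1 + k) / 2 * (a - b) ^ 2
      = a ^ 2 + b ^ 2 - 2 * a * b * k := by ring
  rw [h3] at hconv
  have h4 : Real.cosh √(a ^ 2 + b ^ 2 - 2 * a * b * k) ≤ Real.cosh c := by
    rw [h]; linarith
  rw [Real.cosh_le_cosh, abs_of_nonneg (Real.sqrt_nonneg _), abs_of_nonneg hc] at h4
  exact (Real.sqrt_le_left hc).1 h4

/-- The angles given by the Euclidean law of cosines add up to at most `π`, even when the triangle
inequality fails. -/
theorem arccos_law_of_cosines_add_le {a b c : ℝ} (ha : 0 < a) (hb : 0 < b) (hc : 0 < c) :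
    Real.arccos ((b ^ 2 + c ^ 2 - a ^ 2) / (2 * b * c))
      + Real.arccos ((c ^ 2 + a ^ 2 - b ^ 2) / (2 * c * a))
      + Real.arccos ((a ^ 2 + b ^ 2 - c ^ 2) / (2 * a * b)) ≤ Real.pi := by
  -- `Real.arccos` is `0` beyond `1`, so if one side is at least the sum of the others, two of the
  -- three terms vanish.
  have hzero {x y z : ℝ} (hx : 0 < x) (hy : 0 < y) (h : z ^ 2 ≤ (x - y) ^ 2) :
      Real.arccos ((x ^ 2 + y ^ 2 - z ^ 2) / (2 * x * y)) = 0 := by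
    rw [Real.arccos_eq_zero, le_div_iff₀ (by positivity)]
    nlinarith
  rcases le_or_gt (b + c) a with h1 | h1
  · rw [hzero hc ha (by nlinarith), hzero ha hb (by nlinarith)]
    linarith [Real.arccos_le_pi ((b ^ 2 + c ^ 2 - a ^ 2) / (2 * b * c))]
  rcases le_or_gt (c + a) b with h2 | h2
  · rw [hzero hb hc (by nlinarith), hzero ha hb (by nlinarith)]
    linarith [Real.arccos_le_pi ((c ^ 2 + a ^ 2 - b ^ 2) / (2 * c * a))]
  rcases le_or_gt (a + b) c with h3 | h3
  · rw [hzero hb hc (by nlinarith), hzero hc ha (by nlinarith)]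
    linarith [Real.arccos_le_pi ((a ^ 2 + b ^ 2 - c ^ 2) / (2 * a * b))]
  have hbound {x y z : ℝ} (hx : 0 < x) (hy : 0 < y) (h : z < x + y) (h' : x < y + z)
      (h'' : y < z + x) : -1 ≤ (x ^ 2 + y ^ 2 - z ^ 2) / (2 * x * y) ∧
        (x ^ 2 + y ^ 2 - z ^ 2) / (2 * x * y) ≤ 1 := by
    rw [le_div_iff₀ (by positivity), div_le_iff₀ (by positivity)]
    constructor <;> nlinarith
  have hx := hbound hb hc h1 h2 h3
  have hy := hbound hc ha h2 h3 h1
  have hz := hbound ha hb h3 h1 h2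
  set x := (b ^ 2 + c ^ 2 - a ^ 2) / (2 * b * c) with hxd
  set y := (c ^ 2 + a ^ 2 - b ^ 2) / (2 * c * a) with hyd
  set z := (a ^ 2 + b ^ 2 - c ^ 2) / (2 * a * b) with hzd
  have hprod : √(1 - x ^ 2) * √(1 - y ^ 2) = x * y + z := by
    rw [← Real.sqrt_mul (by nlinarith), Real.sqrt_eq_iff_mul_self_eq]
    · rw [hxd, hyd, hzd]; field_simp; ring
    · exact mul_nonneg (by nlinarith) (by nlinarith)
    · have : x * y + z = ((a + b + c) * (b + c - a) * (c + a - b) * (a + b - c))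
          / (4 * a * b * c ^ 2) := by
        rw [hxd, hyd, hzd]; field_simp; ring
      rw [this]
      have := sub_pos.2 h1
      have := sub_pos.2 h2
      have := sub_pos.2 h3
      positivity
  have hcos : Real.cos (Real.arccos x + Real.arccos y) = -z := by
    rw [Real.cos_add, Real.cos_arccos hx.1 hx.2, Real.cos_arccos hy.1 hy.2, Real.sin_arccos,
      Real.sin_arccos, hprod]
    ring
  -- Needed to invert `cos` on the sum of two angles.
  have hsum : Real.arccos x + Real.arccos y ≤ Real.pi := by
    have : -y ≤ x := by
      have : x + y = (a + b) * ((c + a - b) * (b + c - a)) / (2 * a * b * c) := by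
        rw [hxd, hyd]; field_simp; ring
      have := sub_pos.2 h1
      have := sub_pos.2 h2
      have : 0 ≤ x + y := by
        rw [‹x + y = _›]
        positivity
      linarith
    have := Real.antitone_arccos this
    rw [Real.arccos_neg] at this
    linarith
  have := Real.arccos_cos (add_nonneg (Real.arccos_nonneg x) (Real.arccos_nonneg y)) hsum
  rw [hcos, Real.arccos_neg] at this
  linarith

open Set

/-! ### Solving the geodesic equation -/

theorem coneForm_eq_neg_lorentz (p : Fin 3 → ℝ) : coneForm p = -lorentz p p := by
  unfold coneForm lorentz; ring

theorem lorentz_comm (u v : Fin 3 → ℝ) : lorentz u v = lorentz v u := by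
  unfold lorentz; ring

/-- The solution of `f'' = κ² f` with `f 0 = 0` and `f' 0 = 1`. -/
noncomputable def sinhSlope (κ s : ℝ) : ℝ := if κ = 0 then s else Real.sinh (κ * s) / κ

theorem mul_sinhSlope (κ s : ℝ) : κ * sinhSlope κ s = Real.sinh (κ * s) := by
  unfold sinhSlope
  split_ifs with h
  · simp [h]
  · field_simp

theorem hasDerivAt_sinhSlope (κ s : ℝ) : HasDerivAt (sinhSlope κ) (Real.cosh (κ * s)) s := by
  by_cases h : κ = 0
  · have : sinhSlope κ = id := by ext; simp [sinhSlope, h]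
    rw [this, h]
    simpa using hasDerivAt_id s
  · have : sinhSlope κ = fun s => Real.sinh (κ * s) / κ := by ext; simp [sinhSlope, h]
    rw [this]
    refine ((((hasDerivAt_id s).const_mul κ).sinh).div_const κ).congr_deriv ?_
    simp only [id]
    field_simp

theorem hasDerivAt_cosh_mul (κ s : ℝ) :
    HasDerivAt (fun s => Real.cosh (κ * s)) (κ ^ 2 * sinhSlope κ s) s := by
  refine (((hasDerivAt_id s).const_mul κ).cosh).congr_deriv ?_
  simp only [id]
  rw [← mul_sinhSlope]
  ring

theorem cosh_sq_sub_sinhSlope (κ s : ℝ) :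
    Real.cosh (κ * s) ^ 2 - κ ^ 2 * sinhSlope κ s ^ 2 = 1 := by
  rw [← mul_pow, mul_sinhSlope, Real.cosh_sq]
  ring

theorem hasDerivWithinAt_lorentz {f g : ℝ → Fin 3 → ℝ} {f' g' : Fin 3 → ℝ} {S : Set ℝ} {s : ℝ}
    (hf : HasDerivWithinAt f f' S s) (hg : HasDerivWithinAt g g' S s) :
    HasDerivWithinAt (fun s => lorentz (f s) (g s)) (lorentz f' (g s) + lorentz (f s) g') S s := by
  have hf := hasDerivWithinAt_pi.1 hf
  have hg := hasDerivWithinAt_pi.1 hg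
  unfold lorentz
  refine ((((hf 0).mul (hg 0)).neg.add ((hf 1).mul (hg 1))).add ((hf 2).mul (hg 2))).congr_deriv ?_
  ring

theorem eq_of_hasDerivWithinAt_zero {f : ℝ → ℝ} {a b : ℝ}
    (h : ∀ s ∈ Icc a b, HasDerivWithinAt f 0 (Icc a b) s) : ∀ s ∈ Icc a b, f s = f a := by
  refine constant_of_derivWithin_zero (fun s hs => (h s hs).differentiableWithinAt) fun s hs => ?_
  have hs' := Ico_subset_Icc_self hs
  exact (h s hs').derivWithin (uniqueDiffOn_Icc (hs.1.trans_lt hs.2) s hs')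

/-- `Q` is the endpoint of the unit time geodesic leaving `P` with velocity `u`; `τ` is the
displacement in the `R` factor and `κ` the distance in the `H²` factor. -/
structure IsExp (P Q u : Fin 3 → ℝ) (τ κ : ℝ) : Prop where
  lorentz_left : lorentz P u = -τ * coneForm P
  lorentz_self : lorentz u u = (κ ^ 2 - τ ^ 2) * coneForm P
  nonneg : 0 ≤ κ
  coneForm_target : coneForm Q = Real.exp τ ^ 2 * coneForm P
  target : ∀ i, Q i =
    Real.exp τ * (Real.cosh κ * P i + sinhSlope κ 1 * (u i - τ * P i))

section Solve

variable {γ : ℝ → Fin 3 → ℝ} {P Q : Fin 3 → ℝ}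

theorem IsGeodesicSegment.hasDerivWithinAt (h : IsGeodesicSegment γ P Q) {s : ℝ}
    (hs : s ∈ Icc (0 : ℝ) 1) : HasDerivWithinAt γ (velocity γ s) (Icc 0 1) s :=
  (h.contDiffOn.differentiableOn (by norm_num) s hs).hasDerivWithinAt

theorem IsGeodesicSegment.hasDerivWithinAt_velocity (h : IsGeodesicSegment γ P Q) {s : ℝ}
    (hs : s ∈ Icc (0 : ℝ) 1) :
    HasDerivWithinAt (velocity γ) (acceleration γ s) (Icc 0 1) s := by
  have h2 := h.contDiffOn
  rw [show (2 : WithTop ℕ∞) = 1 + 1 by norm_num,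
    contDiffOn_succ_iff_derivWithin (uniqueDiffOn_Icc one_pos)] at h2
  exact (h2.2.2.differentiableOn (by norm_num) s hs).hasDerivWithinAt

theorem IsGeodesicSegment.acceleration_eq (h : IsGeodesicSegment γ P Q) {s : ℝ}
    (hs : s ∈ Icc (0 : ℝ) 1) : acceleration γ s =
      (-2 * (lorentz (γ s) (velocity γ s) / coneForm (γ s))) • velocity γ s
        + (lorentz (velocity γ s) (velocity γ s) / coneForm (γ s)) • γ s := by
  ext k
  have := h.geodesic_eq s hs k
  rw [christoffel_quadratic (h.mem_space s hs)] at this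
  simp only [Pi.add_apply, Pi.smul_apply, smul_eq_mul]
  linarith

theorem lorentz_add_smul_right (u v w : Fin 3 → ℝ) (a b : ℝ) :
    lorentz u (a • v + b • w) = a * lorentz u v + b * lorentz u w := by
  simp only [lorentz, Pi.add_apply, Pi.smul_apply, smul_eq_mul]; ring

theorem IsGeodesicSegment.hasDerivWithinAt_coneForm (h : IsGeodesicSegment γ P Q) {s : ℝ}
    (hs : s ∈ Icc (0 : ℝ) 1) : HasDerivWithinAt (fun s => coneForm (γ s))
      (-2 * lorentz (γ s) (velocity γ s)) (Icc 0 1) s := by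
  simp only [coneForm_eq_neg_lorentz]
  refine (hasDerivWithinAt_lorentz (h.hasDerivWithinAt hs)
    (h.hasDerivWithinAt hs)).neg.congr_deriv ?_
  rw [lorentz_comm (velocity γ s)]
  ring

/-- Both quotients have zero derivative along a geodesic; `τ` is the constant rate of change of the
height. -/
theorem IsGeodesicSegment.exists_linear (h : IsGeodesicSegment γ P Q) : ∃ τ ν : ℝ,
    ∀ s ∈ Icc (0 : ℝ) 1, lorentz (γ s) (velocity γ s) = -τ * coneForm (γ s) ∧
      lorentz (velocity γ s) (velocity γ s) = ν * coneForm (γ s) ∧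
      acceleration γ s = (2 * τ) • velocity γ s + ν • γ s := by
  have hq {s : ℝ} (hs : s ∈ Icc (0 : ℝ) 1) := (coneForm_pos (h.mem_space s hs)).ne'
  have h1 : ∀ s ∈ Icc (0 : ℝ) 1, lorentz (γ s) (velocity γ s) / coneForm (γ s)
      = lorentz (γ 0) (velocity γ 0) / coneForm (γ 0) := by
    refine eq_of_hasDerivWithinAt_zero fun s hs => ?_
    refine ((hasDerivWithinAt_lorentz (h.hasDerivWithinAt hs)
      (h.hasDerivWithinAt_velocity hs)).div (h.hasDerivWithinAt_coneForm hs)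
      (hq hs)).congr_deriv ?_
    have := hq hs
    rw [h.acceleration_eq hs, lorentz_add_smul_right,
      show lorentz (γ s) (γ s) = -coneForm (γ s) by rw [coneForm_eq_neg_lorentz, neg_neg]]
    field_simp
    ring
  have h2 : ∀ s ∈ Icc (0 : ℝ) 1, lorentz (velocity γ s) (velocity γ s) / coneForm (γ s)
      = lorentz (velocity γ 0) (velocity γ 0) / coneForm (γ 0) := by
    refine eq_of_hasDerivWithinAt_zero fun s hs => ?_
    refine ((hasDerivWithinAt_lorentz (h.hasDerivWithinAt_velocity hs)
      (h.hasDerivWithinAt_velocity hs)).div (h.hasDerivWithinAt_coneForm hs)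
      (hq hs)).congr_deriv ?_
    have := hq hs
    rw [h.acceleration_eq hs, lorentz_comm _ (velocity γ s), lorentz_add_smul_right,
      lorentz_comm (velocity γ s) (γ s)]
    field_simp
    ring
  refine ⟨-(lorentz (γ 0) (velocity γ 0) / coneForm (γ 0)),
    lorentz (velocity γ 0) (velocity γ 0) / coneForm (γ 0), fun s hs => ⟨?_, ?_, ?_⟩⟩
  · rw [← h1 s hs, neg_neg, div_mul_cancel₀ _ (hq hs)]
  · rw [← h2 s hs, div_mul_cancel₀ _ (hq hs)]
  · rw [h.acceleration_eq hs, h1 s hs, h2 s hs]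
    congr 2
    ring

/-- The Lorentzian form is positive semidefinite on the complement of a point of `space`. -/
theorem lorentz_self_nonneg {P u : Fin 3 → ℝ} (hP : P ∈ space) (hu : lorentz P u = 0) :
    0 ≤ lorentz u u := by
  have hq := coneForm_pos hP
  have h0 : P 0 * u 0 = P 1 * u 1 + P 2 * u 2 := by
    unfold lorentz at hu; linarith
  have h : P 0 ^ 2 * lorentz u u
      = coneForm P * (u 1 ^ 2 + u 2 ^ 2) + (P 1 * u 2 - P 2 * u 1) ^ 2 := by
    unfold lorentz coneForm
    linear_combination (-(P 0 * u 0) - (P 1 * u 1 + P 2 * u 2)) * h0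
  exact nonneg_of_mul_nonneg_right (h ▸ by positivity) (pow_pos hP.2 2)

theorem eq_zero_of_lorentz_self_eq_zero {P u : Fin 3 → ℝ} (hP : P ∈ space)
    (hu : lorentz P u = 0) (huu : lorentz u u = 0) : u = 0 := by
  have hq := coneForm_pos hP
  have h0 : P 0 * u 0 = P 1 * u 1 + P 2 * u 2 := by
    unfold lorentz at hu; linarith
  have h : P 0 ^ 2 * lorentz u u
      = coneForm P * (u 1 ^ 2 + u 2 ^ 2) + (P 1 * u 2 - P 2 * u 1) ^ 2 := by
    unfold lorentz coneForm
    linear_combination (-(P 0 * u 0) - (P 1 * u 1 + P 2 * u 2)) * h0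
  rw [huu, mul_zero] at h
  have h12 : u 1 ^ 2 + u 2 ^ 2 = 0 := by
    refine le_antisymm (nonpos_of_mul_nonpos_right ?_ hq) (by positivity)
    linarith [sq_nonneg (P 1 * u 2 - P 2 * u 1)]
  have h1 : u 1 = 0 := by nlinarith [sq_nonneg (u 1), sq_nonneg (u 2)]
  have h2 : u 2 = 0 := by nlinarith [sq_nonneg (u 1), sq_nonneg (u 2)]
  rw [h1, h2] at h0
  have h3 : u 0 = 0 := by simpa [hP.2.ne'] using h0
  ext i
  fin_cases i <;> simpa

/-- Cauchy–Schwarz on the spacelike plane orthogonal to `P`: the Gram determinant is a positive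
multiple of a square. -/
theorem lorentz_sq_le {P u v : Fin 3 → ℝ} (hP : P ∈ space) (hu : lorentz P u = 0)
    (hv : lorentz P v = 0) : lorentz u v ^ 2 ≤ lorentz u u * lorentz v v := by
  have hq := coneForm_pos hP
  have h0 := hP.2.ne'
  have hu0 : u 0 = (P 1 * u 1 + P 2 * u 2) / P 0 := by
    rw [eq_div_iff h0]; unfold lorentz at hu; linarith
  have hv0 : v 0 = (P 1 * v 1 + P 2 * v 2) / P 0 := by
    rw [eq_div_iff h0]; unfold lorentz at hv; linarith
  have h : lorentz u u * lorentz v v - lorentz u v ^ 2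
      = coneForm P * (u 1 * v 2 - u 2 * v 1) ^ 2 / P 0 ^ 2 := by
    unfold lorentz coneForm
    rw [hu0, hv0]
    field_simp
    ring
  have : 0 ≤ coneForm P * (u 1 * v 2 - u 2 * v 1) ^ 2 / P 0 ^ 2 := by positivity
  linarith

/-- A geodesic segment is given by the explicit exponential map at both of its ends. -/
theorem IsGeodesicSegment.exists_isExp (h : IsGeodesicSegment γ P Q) : ∃ τ κ : ℝ,
    IsExp P Q (velocity γ 0) τ κ ∧ IsExp Q P (-velocity γ 1) (-τ) κ := by
  obtain ⟨τ, ν, hlin⟩ := h.exists_linear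
  have m0 : (0 : ℝ) ∈ Icc (0 : ℝ) 1 := by simp
  have m1 : (1 : ℝ) ∈ Icc (0 : ℝ) 1 := by simp
  -- The horizontal part `γ' - τγ` is orthogonal to `γ` and has Lorentzian square `(ν + τ²) q`.
  have hκ : 0 ≤ ν + τ ^ 2 := by
    have hP := h.mem_space 0 m0
    have hq := coneForm_pos hP
    obtain ⟨e1, e2, -⟩ := hlin 0 m0
    have hv : lorentz (γ 0) (velocity γ 0 - τ • γ 0) = 0 := by
      have : lorentz (γ 0) (velocity γ 0 - τ • γ 0)
          = lorentz (γ 0) (velocity γ 0) + τ * coneForm (γ 0) := by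
        simp only [lorentz, coneForm, Pi.sub_apply, Pi.smul_apply, smul_eq_mul]; ring
      rw [this, e1]; ring
    have hn := lorentz_self_nonneg hP hv
    have : lorentz (velocity γ 0 - τ • γ 0) (velocity γ 0 - τ • γ 0)
        = lorentz (velocity γ 0) (velocity γ 0) - 2 * τ * lorentz (γ 0) (velocity γ 0)
          - τ ^ 2 * coneForm (γ 0) := by
      simp only [lorentz, coneForm, Pi.sub_apply, Pi.smul_apply, smul_eq_mul]; ring
    rw [this, e1, e2] at hn
    exact nonneg_of_mul_nonneg_left (by linarith) hq
  obtain ⟨κ, hκ0, hκν⟩ : ∃ κ : ℝ, 0 ≤ κ ∧ κ ^ 2 = ν + τ ^ 2 :=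
    ⟨√(ν + τ ^ 2), Real.sqrt_nonneg _, Real.sq_sqrt hκ⟩
  have hν : ν = κ ^ 2 - τ ^ 2 := by linarith
  have hexp (a s : ℝ) : HasDerivWithinAt (fun s : ℝ => Real.exp (a * s))
      (Real.exp (a * s) * a) (Icc 0 1) s := by
    simpa using (((hasDerivAt_id s).const_mul a).exp).hasDerivWithinAt
  have hq : coneForm (γ 1) = Real.exp τ ^ 2 * coneForm (γ 0) := by
    have := eq_of_hasDerivWithinAt_zero (f := fun s => Real.exp (-2 * τ * s) * coneForm (γ s))
      (fun s hs => ((hexp (-2 * τ) s).mul (h.hasDerivWithinAt_coneForm hs)).congr_deriv (by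
        rw [(hlin s hs).1]; ring)) 1 m1
    simp only [mul_one, mul_zero, Real.exp_zero, one_mul] at this
    rw [← this, ← Real.exp_nat_mul, ← mul_assoc, ← Real.exp_add]
    push_cast
    ring_nf
    simp
  -- Flowing the state at time `s` back to time `0` by the explicit solution gives a quantity
  -- constant in `s`; this replaces ODE uniqueness.
  have hback (i : Fin 3) : Real.exp (-τ) * (Real.cosh κ * γ 1 i
      - sinhSlope κ 1 * (velocity γ 1 i - τ * γ 1 i)) = γ 0 i := by
    have := eq_of_hasDerivWithinAt_zero (f := fun s => Real.exp (-τ * s) *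
        (Real.cosh (κ * s) * γ s i - sinhSlope κ s * (velocity γ s i - τ * γ s i)))
      (fun s hs => by
        have d1 := hasDerivWithinAt_pi.1 (h.hasDerivWithinAt hs) i
        have d2 := hasDerivWithinAt_pi.1 (h.hasDerivWithinAt_velocity hs) i
        refine ((hexp (-τ) s).mul (((hasDerivAt_cosh_mul κ s).hasDerivWithinAt.mul d1).sub
          ((hasDerivAt_sinhSlope κ s).hasDerivWithinAt.mul
            (d2.sub (d1.const_mul τ))))).congr_deriv ?_
        rw [(hlin s hs).2.2, hν]
        simp only [Pi.add_apply, Pi.smul_apply, Pi.sub_apply, Pi.mul_apply, smul_eq_mul]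
        ring) 1 m1
    simpa [sinhSlope] using this
  have hforw (i : Fin 3) : Real.exp (-τ) * (Real.cosh κ * (velocity γ 1 i - τ * γ 1 i)
      - κ ^ 2 * sinhSlope κ 1 * γ 1 i) = velocity γ 0 i - τ * γ 0 i := by
    have := eq_of_hasDerivWithinAt_zero (f := fun s => Real.exp (-τ * s) *
        (Real.cosh (κ * s) * (velocity γ s i - τ * γ s i) - κ ^ 2 * sinhSlope κ s * γ s i))
      (fun s hs => by
        have d1 := hasDerivWithinAt_pi.1 (h.hasDerivWithinAt hs) i
        have d2 := hasDerivWithinAt_pi.1 (h.hasDerivWithinAt_velocity hs) i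
        refine ((hexp (-τ) s).mul (((hasDerivAt_cosh_mul κ s).hasDerivWithinAt.mul
          (d2.sub (d1.const_mul τ))).sub
          (((hasDerivAt_sinhSlope κ s).hasDerivWithinAt.const_mul (κ ^ 2)).mul
            d1))).congr_deriv ?_
        rw [(hlin s hs).2.2, hν]
        simp only [Pi.add_apply, Pi.smul_apply, Pi.sub_apply, Pi.mul_apply, smul_eq_mul]
        ring) 1 m1
    simpa [sinhSlope] using this
  have hcs := cosh_sq_sub_sinhSlope κ 1
  rw [mul_one] at hcs
  have hee : Real.exp τ * Real.exp (-τ) = 1 := by rw [← Real.exp_add]; simp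
  obtain ⟨a0, b0, -⟩ := hlin 0 m0
  obtain ⟨a1, b1, -⟩ := hlin 1 m1
  refine ⟨τ, κ, ⟨?_, ?_, hκ0, ?_, fun i => ?_⟩, ⟨?_, ?_, hκ0, ?_, fun i => ?_⟩⟩
  · rw [← h.source, a0]
  · rw [← h.source, b0, hν]
  · rw [← h.source, ← h.target, hq]
  -- Inverts the backward flow, whose matrix has determinant `cosh² - κ² sinhSlope² = 1` up to the
  -- exponential factor.
  · rw [← h.source, ← h.target, ← hforw, ← hback]
    linear_combination (-γ 1 i) * hcs - (γ 1 i * (Real.cosh κ ^ 2 - κ ^ 2 * sinhSlope κ 1 ^ 2)) * hee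
  · rw [← h.target]
    have : lorentz (γ 1) (-velocity γ 1) = -lorentz (γ 1) (velocity γ 1) := by
      simp only [lorentz, Pi.neg_apply]; ring
    rw [this, a1]; ring
  · rw [← h.target]
    have : lorentz (-velocity γ 1) (-velocity γ 1) = lorentz (velocity γ 1) (velocity γ 1) := by
      simp only [lorentz, Pi.neg_apply]; ring
    rw [this, b1, hν]; ring
  · rw [← h.source, ← h.target, hq, ← mul_assoc, ← mul_pow, mul_comm (Real.exp (-τ)), hee]
    ring
  · rw [← h.source, ← h.target, ← hback, Pi.neg_apply]
    ring

end Solve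

/-! ### Law of cosines and angle comparison -/

theorem IsExp.lorentz_horizontal {P Q u : Fin 3 → ℝ} {τ κ : ℝ} (h : IsExp P Q u τ κ) :
    lorentz P (u - τ • P) = 0 := by
  have := h.lorentz_left
  simp only [lorentz, coneForm, Pi.sub_apply, Pi.smul_apply, smul_eq_mul] at *
  linear_combination this

theorem IsExp.lorentz_horizontal_self {P Q u : Fin 3 → ℝ} {τ κ : ℝ} (h : IsExp P Q u τ κ) :
    lorentz (u - τ • P) (u - τ • P) = κ ^ 2 * coneForm P := by
  have h1 := h.lorentz_left
  have h2 := h.lorentz_self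
  simp only [lorentz, coneForm, Pi.sub_apply, Pi.smul_apply, smul_eq_mul] at *
  linear_combination h2 - 2 * τ * h1

theorem IsExp.metricInner_eq {P Q R u v : Fin 3 → ℝ} {τ κ τ' κ' : ℝ} (hP : P ∈ space)
    (h : IsExp P Q u τ κ) (h' : IsExp P R v τ' κ') :
    metricInner P u v = lorentz (u - τ • P) (v - τ' • P) / coneForm P + τ * τ' := by
  have hq := (coneForm_pos hP).ne'
  have : lorentz (u - τ • P) (v - τ' • P) = lorentz u v + τ * τ' * coneForm P := by
    have h1 := h.lorentz_left
    have h2 := h'.lorentz_left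
    simp only [lorentz, coneForm, Pi.sub_apply, Pi.smul_apply, smul_eq_mul] at *
    linear_combination - τ' * h1 - τ * h2
  rw [H2R.metricInner_eq hP, h.lorentz_left, h'.lorentz_left, this]
  field_simp
  ring

theorem IsExp.metricInner_self {P Q u : Fin 3 → ℝ} {τ κ : ℝ} (hP : P ∈ space)
    (h : IsExp P Q u τ κ) : metricInner P u u = τ ^ 2 + κ ^ 2 := by
  have hq := (coneForm_pos hP).ne'
  rw [h.metricInner_eq hP h, h.lorentz_horizontal_self]
  field_simp
  ring

theorem IsExp.length_pos {P Q u : Fin 3 → ℝ} {τ κ : ℝ} (hP : P ∈ space)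
    (h : IsExp P Q u τ κ) (hne : P ≠ Q) : 0 < τ ^ 2 + κ ^ 2 := by
  refine lt_of_le_of_ne (by positivity) fun h0 => hne ?_
  have hτ : τ = 0 := by nlinarith [sq_nonneg τ, sq_nonneg κ]
  have hκ : κ = 0 := by nlinarith [sq_nonneg τ, sq_nonneg κ]
  subst hτ hκ
  have hu : u = 0 := eq_zero_of_lorentz_self_eq_zero hP (by simpa using h.lorentz_left)
    (by simpa using h.lorentz_self)
  ext i
  simpa [hu] using (h.target i).symm

theorem IsExp.lorentz_target {P Q R u v : Fin 3 → ℝ} {τ κ τ' κ' : ℝ}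
    (h : IsExp P Q u τ κ) (h' : IsExp P R v τ' κ') :
    lorentz Q R = -(Real.exp τ * Real.exp τ' * (Real.cosh κ * Real.cosh κ' * coneForm P
      - sinhSlope κ 1 * sinhSlope κ' 1 * lorentz (u - τ • P) (v - τ' • P))) := by
  have h1 := h.lorentz_horizontal
  have h2 := h'.lorentz_horizontal
  have e1 := h.target
  have e2 := h'.target
  simp only [lorentz, coneForm, Pi.sub_apply, Pi.smul_apply, smul_eq_mul] at *
  rw [e1 0, e1 1, e1 2, e2 0, e2 1, e2 2]
  linear_combination Real.exp τ * Real.exp τ' * (Real.cosh κ * sinhSlope κ' 1 * h2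
    + Real.cosh κ' * sinhSlope κ 1 * h1)

theorem IsExp.lorentz_source_target {P Q u : Fin 3 → ℝ} {τ κ : ℝ} (h : IsExp P Q u τ κ) :
    lorentz P Q = -(Real.exp τ * Real.cosh κ * coneForm P) := by
  have h1 := h.lorentz_horizontal
  have e1 := h.target
  simp only [lorentz, coneForm, Pi.sub_apply, Pi.smul_apply, smul_eq_mul] at *
  rw [e1 0, e1 1, e1 2]
  linear_combination Real.exp τ * sinhSlope κ 1 * h1

/-- The law of cosines inequality of nonpositive curvature. -/
theorem IsExp.law_of_cosines {P Q R u v w : Fin 3 → ℝ} {τ₁ κ₁ τ₂ κ₂ τ₃ κ₃ : ℝ}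
    (hP : P ∈ space) (h₁ : IsExp P Q u τ₁ κ₁) (h₂ : IsExp P R v τ₂ κ₂)
    (h₃ : IsExp Q R w τ₃ κ₃) :
    (τ₁ ^ 2 + κ₁ ^ 2) + (τ₂ ^ 2 + κ₂ ^ 2) - (τ₃ ^ 2 + κ₃ ^ 2) ≤ 2 * metricInner P u v := by
  have hq := coneForm_pos hP
  -- Computing `coneForm R` along both routes from `P` shows that height changes add.
  have hexp : Real.exp τ₂ = Real.exp τ₃ * Real.exp τ₁ := by
    have := h₃.coneForm_target
    rw [h₁.coneForm_target, h₂.coneForm_target, ← mul_assoc, ← mul_pow] at this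
    exact (pow_left_inj₀ (by positivity) (by positivity) two_ne_zero).1
      (mul_right_cancel₀ hq.ne' this)
  have hτ : τ₂ = τ₃ + τ₁ := by
    rw [← Real.exp_add] at hexp
    exact Real.exp_injective hexp
  set m := lorentz (u - τ₁ • P) (v - τ₂ • P) / coneForm P with hm
  have hmq : lorentz (u - τ₁ • P) (v - τ₂ • P) = m * coneForm P := by
    rw [hm, div_mul_cancel₀ _ hq.ne']
  have hmle : m ^ 2 ≤ (κ₁ * κ₂) ^ 2 := by
    have := lorentz_sq_le hP h₁.lorentz_horizontal h₂.lorentz_horizontal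
    rw [hmq, h₁.lorentz_horizontal_self, h₂.lorentz_horizontal_self] at this
    refine le_of_mul_le_mul_right ?_ (pow_pos hq 2)
    linarith
  -- `k` is the cosine of the angle between the horizontal parts, set to `0` if one of them
  -- vanishes.
  obtain ⟨k, hk, hmk⟩ : ∃ k : ℝ, |k| ≤ 1 ∧ m = κ₁ * κ₂ * k := by
    rcases eq_or_ne (κ₁ * κ₂) 0 with h0 | h0
    · refine ⟨0, by simp, ?_⟩
      rw [h0] at hmle
      rw [mul_zero]
      nlinarith
    · refine ⟨m / (κ₁ * κ₂), ?_, by rw [mul_div_assoc', mul_div_cancel_left₀ m h0]⟩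
      rw [abs_div, div_le_one (abs_pos.2 h0)]
      exact sq_le_sq.1 hmle
  -- Compares two expressions for `⟨Q, R⟩`: one based at `P`, one along the side `QR`.
  have hcosh : Real.cosh κ₃
      = Real.cosh κ₁ * Real.cosh κ₂ - Real.sinh κ₁ * Real.sinh κ₂ * k := by
    have h := h₃.lorentz_source_target
    rw [h₁.lorentz_target h₂, h₁.coneForm_target, hmq, hmk, hexp] at h
    have s₁ := mul_sinhSlope κ₁ 1
    have s₂ := mul_sinhSlope κ₂ 1
    rw [mul_one] at s₁ s₂
    rw [← s₁, ← s₂]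
    refine mul_left_cancel₀
      (show Real.exp τ₃ * Real.exp τ₁ ^ 2 * coneForm P ≠ 0 by positivity) ?_
    linear_combination h
  have := sq_ge_of_hyperbolic_law_of_cosines h₃.nonneg hk hcosh
  rw [h₁.metricInner_eq hP h₂, ← hm, hmk, hτ]
  linarith

theorem IsExp.angle_le {P Q R u v w : Fin 3 → ℝ} {τ₁ κ₁ τ₂ κ₂ τ₃ κ₃ : ℝ}
    (hP : P ∈ space) (h₁ : IsExp P Q u τ₁ κ₁) (h₂ : IsExp P R v τ₂ κ₂)
    (h₃ : IsExp Q R w τ₃ κ₃) :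
    angle P u v ≤ Real.arccos ((√(τ₁ ^ 2 + κ₁ ^ 2) ^ 2 + √(τ₂ ^ 2 + κ₂ ^ 2) ^ 2
      - √(τ₃ ^ 2 + κ₃ ^ 2) ^ 2) / (2 * √(τ₁ ^ 2 + κ₁ ^ 2) * √(τ₂ ^ 2 + κ₂ ^ 2))) := by
  refine Real.antitone_arccos ?_
  rw [h₁.metricInner_self hP, h₂.metricInner_self hP, Real.sqrt_mul (by positivity),
    Real.sq_sqrt (by positivity), Real.sq_sqrt (by positivity), Real.sq_sqrt (by positivity),
    mul_assoc, ← div_div]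
  gcongr
  linarith [h₁.law_of_cosines hP h₂ h₃]

end H2R

/-! ### The angle sum -/

theorem theorem3p10 (T : H2R.GeodesicTriangle) :
    ∑ k, T.interiorAngle k ≤ Real.pi := by
  choose τ κ hforward hbackward using fun k => (T.side_geodesic k).exists_isExp
  have hpos (k : Fin 3) : 0 < √(τ k ^ 2 + κ k ^ 2) :=
    Real.sqrt_pos.2 ((hforward k).length_pos (T.vertex_mem _)
      (T.vertex_injective.ne (by revert k; decide)))
  have hangle (k : Fin 3) : T.interiorAngle k ≤ Real.arccos
      ((√(τ (k + 2) ^ 2 + κ (k + 2) ^ 2) ^ 2 + √(τ (k + 1) ^ 2 + κ (k + 1) ^ 2) ^ 2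
        - √(τ k ^ 2 + κ k ^ 2) ^ 2)
      / (2 * √(τ (k + 2) ^ 2 + κ (k + 2) ^ 2) * √(τ (k + 1) ^ 2 + κ (k + 1) ^ 2))) := by
    -- Side `k + 2` starts at vertex `k`, while side `k + 1` ends there and is reversed, which only
    -- flips the sign of its `τ`.
    have h₁ := hforward (k + 2)
    have h₂ := hbackward (k + 1)
    rw [(by decide : ∀ k : Fin 3, k + 2 + 1 = k) k, (by decide : ∀ k : Fin 3, k + 2 + 2 = k + 1) k] at h₁
    rw [(by decide : ∀ k : Fin 3, k + 1 + 2 = k) k, (by decide : ∀ k : Fin 3, k + 1 + 1 = k + 2) k] at h₂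
    have := h₁.angle_le (T.vertex_mem k) h₂ (hforward k)
    rwa [neg_sq] at this
  have h0 := hangle 0
  have h1 := hangle 1
  have h2 := hangle 2
  simp only [zero_add, show (1 : Fin 3) + 2 = 0 from rfl, show (1 : Fin 3) + 1 = 2 from rfl,
    show (2 : Fin 3) + 2 = 1 from rfl, show (2 : Fin 3) + 1 = 0 from rfl] at h0 h1 h2
  have hsum := H2R.arccos_law_of_cosines_add_le (hpos 0) (hpos 2) (hpos 1)
  rw [Fin.sum_univ_three]
  linarith
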